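/- Let $F/\mathbf{F}_q$ be an algebraic function field of one variable over a finite field $\mathbf{F}_q$, let $Q, P_1,\dots,P_n$ be $n+1$ distinct places of degree one of $F$, and let $v_P$ denote the normalized discrete valuation at a place $P$. Put $D=P_1+\cdots+P_n$. For a divisor $G$ let $\mathcal{L}(-G+\infty Q)=\bigcup_{i\ge 1}\mathcal{L}(-G+iQ)$, and let $\mathcal{L}(\infty Q)=\bigcup_{i\ge 1}\mathcal{L}(iQ)$. Let $a_1\ge 1$ be an integer and let $x_1\in F$ have pole divisor $(x_1)_\infty=a_1Q$. Let $\vec r=(r_1,\dots,r_n)\in\mathbf{F}_q^n$ and let $h_{\vec r}\in\mathcal{L}(\infty Q)$ satisfy $h_{\vec r}(P_k)=r_k$ for all $k$. Let $0\le m\le \ell$ be integers. For $0\le i\le m$ and $0\le j<a_1$ let $\eta_{i,j}$ be a nonzero element of $\mathcal{L}(-iD+\infty Q)$ with $-v_Q(\eta_{i,j})\equiv j \pmod{a_1}$ such that $-v_Q(\eta_{i,j})$ is minimal among the pole orders $-v_Q(\eta)$ of the nonzero $\eta\in\mathcal{L}(-iD+\infty Q)$ with $-v_Q(\eta)\equiv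 j\pmod{a_1}$. A polynomial $p(Z)\in\mathcal{L}(\infty Q)[Z]$ is said to have multiplicity $m$ at $(P_k,r_k)$ if, writing $p(Z+r_k)=\sum_t c_tZ^t$, one has $v_{P_k}(c_t)\ge m-t$ for every $t\ge 0$ (where $v_{P_k}(0)=\infty$). Let $I_{\vec r,m,\ell}$ be the set of all $p(Z)\in\mathcal{L}(\infty Q)[Z]$ with $\deg_Z p\le\ell$ that have multiplicity $m$ at $(P_k,r_k)$ for every $k=1,\dots,n$. Then $I_{\vec r,m,\ell}$ is the $\mathbf{F}_q[x_1]$-submodule of $\mathcal{L}(\infty Q)[Z]$ generated by $$\{(Z-h_{\vec r})^{m-i}\eta_{i,j}\mid 0\le i\le m,\ 0\le j<a_1\}\ \cup\ \{Z^{\ell'-m}(Z-h_{\vec r})^m\eta_{0,j}\mid m<\ell'\le\ell,\ 0\le j<a_1\}.$$ -/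

import Mathlib

open Polynomial

/-- `F` is an algebraic function field of one variable over `K`: it is a finite extension of
`K(x)` for some `x ∈ F` that is transcendental over `K`. -/
def IsAlgebraicFunctionField (K F : Type*) [Field K] [Field F] [Algebra K F] : Prop :=
  ∃ x : F, Transcendental K x ∧ FiniteDimensional (IntermediateField.adjoin K {x}) F

/-- A place of `F / K`, given by its normalized discrete valuation `F → ℤ ∪ {∞}`, trivial
on `K`. The value group is written multiplicatively, as everywhere in Mathlib. -/
@[ext]
structure Place (K F : Type*) [Field K] [Field F] [Algebra K F] where
  val : Valuation F (WithZero (Multiplicative ℤ))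
  surjective : Function.Surjective val
  trivial_on : ∀ c : K, c ≠ 0 → val (algebraMap K F c) = 1

namespace Place

variable {K F : Type*} [Field K] [Field F] [Algebra K F]

theorem val_algebraMap_le_one (P : Place K F) (c : K) : P.val (algebraMap K F c) ≤ 1 := by
  by_cases hc : c = 0
  · simp [hc]
  · exact (P.trivial_on c hc).le

/-- The valuation ring `O_P` of the place `P`. -/
abbrev ring (P : Place K F) : ValuationSubring F := P.val.valuationSubring

noncomputable instance (P : Place K F) : Algebra K P.ring :=
  ((algebraMap K F).codRestrict P.ring.toSubring
    (fun c => P.val_algebraMap_le_one c)).toAlgebra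

/-- The degree of a place: the degree over `K` of its residue field. -/
noncomputable def deg (P : Place K F) : ℕ :=
  Module.finrank K (IsLocalRing.ResidueField P.ring)

/-- The additive valuation `v_P(f) ∈ ℤ` of `f ≠ 0` (with the irrelevant value `0` at `f = 0`). -/
noncomputable def ord (P : Place K F) (f : F) : ℤ := -WithZero.log (P.val f)

/-- `f(P) = c`, for `c ∈ K`: the function `f` is congruent to `c` modulo the maximal ideal
of `O_P`. -/
def HasValue (P : Place K F) (f : F) (c : K) : Prop := P.val (f - algebraMap K F c) < 1

theorem ord_mul (P : Place K F) {f g : F} (hf : f ≠ 0) (hg : g ≠ 0) :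
    P.ord (f * g) = P.ord f + P.ord g := by
  have h1 : P.val f ≠ 0 := (Valuation.ne_zero_iff _).2 hf
  have h2 : P.val g ≠ 0 := (Valuation.ne_zero_iff _).2 hg
  simp only [ord, map_mul, WithZero.log_mul h1 h2]
  ring

theorem min_ord_le_ord_add (P : Place K F) {f g : F} (hf : f ≠ 0) (hg : g ≠ 0)
    (hfg : f + g ≠ 0) : min (P.ord f) (P.ord g) ≤ P.ord (f + g) := by
  have h1 : P.val f ≠ 0 := (Valuation.ne_zero_iff _).2 hf
  have h2 : P.val g ≠ 0 := (Valuation.ne_zero_iff _).2 hg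
  have h3 : P.val (f + g) ≠ 0 := (Valuation.ne_zero_iff _).2 hfg
  have h := P.val.map_add f g
  simp only [ord]
  rcases le_max_iff.1 h with h | h
  · have := (WithZero.log_le_log h3 h1).2 h
    exact (min_le_left _ _).trans (neg_le_neg this)
  · have := (WithZero.log_le_log h3 h2).2 h
    exact (min_le_right _ _).trans (neg_le_neg this)

theorem ord_algebraMap (P : Place K F) (c : K) : P.ord (algebraMap K F c) = 0 := by
  by_cases hc : c = 0
  · simp [ord, hc]
  · simp [ord, P.trivial_on c hc]

end Place

/-- Divisors of `F / K`. -/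
abbrev FFDivisor (K F : Type*) [Field K] [Field F] [Algebra K F] := Place K F →₀ ℤ

section

variable {K F : Type*} [Field K] [Field F] [Algebra K F]

/-- The place `P` as a prime divisor. -/
noncomputable def Place.toDivisor (P : Place K F) : FFDivisor K F := Finsupp.single P 1

/-- The pole divisor `(f)_∞` of the nonzero function `f` is the divisor `A`. -/
def HasPoleDivisor (f : F) (A : FFDivisor K F) : Prop :=
  f ≠ 0 ∧ ∀ P : Place K F, max (-P.ord f) 0 = A P

/-- The Riemann-Roch space `L(A) = {f | (f) + A ≥ 0} ∪ {0}`. -/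
def riemannRochSpace (A : FFDivisor K F) : Set F :=
  {f | f = 0 ∨ ∀ P : Place K F, 0 ≤ P.ord f + A P}

/-- `L(A + ∞Q)`, the union of the spaces `L(A + iQ)` over `i ≥ 1`. -/
def spaceInfty (A : FFDivisor K F) (Q : Place K F) : Set F :=
  ⋃ i ∈ Set.Ici (1 : ℕ), riemannRochSpace (A + i • Q.toDivisor)

theorem toDivisor_nonneg (P Q : Place K F) : 0 ≤ Q.toDivisor P := by
  classical
  simp only [Place.toDivisor, Finsupp.single_apply]
  split_ifs <;> norm_num

theorem mem_spaceInfty_zero {Q : Place K F} {f : F} :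
    f ∈ spaceInfty 0 Q ↔
      ∃ i : ℕ, 1 ≤ i ∧ (f = 0 ∨ ∀ P : Place K F, 0 ≤ P.ord f + i * Q.toDivisor P) := by
  simp [spaceInfty, riemannRochSpace]

/-- The ring `L(∞Q)`. -/
def ringInfty (Q : Place K F) : Subalgebra K F where
  carrier := spaceInfty 0 Q
  mul_mem' := by
    intro f g hf hg
    rw [mem_spaceInfty_zero] at hf hg ⊢
    obtain ⟨i, hi, hf⟩ := hf
    obtain ⟨j, hj, hg⟩ := hg
    refine ⟨i + j, by omega, ?_⟩
    by_cases hf0 : f = 0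
    · exact Or.inl (by simp [hf0])
    by_cases hg0 : g = 0
    · exact Or.inl (by simp [hg0])
    right
    intro P
    have h1 := hf.resolve_left hf0 P
    have h2 := hg.resolve_left hg0 P
    rw [P.ord_mul hf0 hg0]
    push_cast
    linarith
  add_mem' := by
    intro f g hf hg
    by_cases hf0 : f = 0
    · simpa [hf0] using hg
    by_cases hg0 : g = 0
    · simpa [hg0] using hf
    rw [mem_spaceInfty_zero] at hf hg ⊢
    obtain ⟨i, hi, hf⟩ := hf
    obtain ⟨j, hj, hg⟩ := hg
    refine ⟨i + j, by omega, ?_⟩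
    by_cases hfg : f + g = 0
    · exact Or.inl hfg
    right
    intro P
    have h1 := hf.resolve_left hf0 P
    have h2 := hg.resolve_left hg0 P
    have h3 := P.min_ord_le_ord_add hf0 hg0 hfg
    have hQ := toDivisor_nonneg P Q
    have h4 : 0 ≤ (i : ℤ) * Q.toDivisor P := by positivity
    have h5 : 0 ≤ (j : ℤ) * Q.toDivisor P := by positivity
    push_cast
    rcases min_le_iff.1 h3 with h | h <;> linarith
  algebraMap_mem' := by
    intro c
    rw [mem_spaceInfty_zero]
    refine ⟨1, le_rfl, Or.inr fun P => ?_⟩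
    rw [P.ord_algebraMap]
    simpa using toDivisor_nonneg P Q

/-- The polynomial `p ∈ L(∞Q)[Z]` has multiplicity (at least) `m` at the point `(P, r)`:
after the translation `Z ↦ Z + r`, every monomial `c Z ^ t` of `p` satisfies
`v_P(c) + t ≥ m`. -/
def HasMultiplicity {Q : Place K F} (p : (ringInfty Q)[X]) (P : Place K F) (r : K) (m : ℕ) :
    Prop :=
  ∀ t : ℕ,
    let c : F := ((p.comp (X + C (algebraMap K (ringInfty Q) r))).coeff t : F)
    c = 0 ∨ (m : ℤ) ≤ P.ord c + t

/-- The set `I_{r,m,ℓ}` of all polynomials in `L(∞Q)[Z]` of `Z`-degree at most `ℓ` that have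
multiplicity `m` at all the points `(P_i, r_i)`. -/
def interpolationModule (Q : Place K F) {n : ℕ} (P : Fin n → Place K F) (r : Fin n → K)
    (m ℓ : ℕ) : Set (ringInfty Q)[X] :=
  {p | (∀ i, HasMultiplicity p (P i) (r i) m) ∧ p.degree ≤ ℓ}

/-- `g` is a (nonzero) element of `L(A + ∞Q)` whose pole order `-v_Q(g)` at `Q` is the minimum
among the pole orders of nonzero elements of `L(A + ∞Q)` that are congruent to `j` modulo `a`. -/
def IsMinimalPoleOrder (A : FFDivisor K F) (Q : Place K F) (a j : ℕ) (g : F) : Prop :=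
  (g ∈ spaceInfty A Q ∧ g ≠ 0 ∧ -Q.ord g ≡ j [ZMOD a]) ∧
    ∀ f : F, f ∈ spaceInfty A Q → f ≠ 0 → -Q.ord f ≡ j [ZMOD a] → -Q.ord g ≤ -Q.ord f

end

/-!
Since `h - r_k` vanishes at `P_k`, the condition of multiplicity `m` at `(P_k, r_k)` does not change
when `p` is expanded in powers of `Z - h` instead of `Z - r_k`. In this expansion all the conditions
together say that the coefficient of `(Z - h) ^ t` lies in `L(-(m - t)D + ∞Q)` for `t < m`. Thus `p`
is a sum of terms `(Z - h) ^ (m - i) c` with `c ∈ L(-iD + ∞Q)`, and of a multiple of `(Z - h) ^ m`,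
whose cofactor is expanded in powers of `Z`.

It remains to see that the `η_{i,j}` generate `L(-iD + ∞Q)` over `K[x₁]`. A nonzero `f` in this
space has the same pole order at `Q` as `x₁ ^ d η_{i,j}`, where `j` is the residue class of its pole
order and `d ≥ 0` by minimality. As `Q` has degree one, subtracting a constant multiple of this
element lowers the pole order; this stops because the pole orders are bounded below.
-/

section WeightedPolynomials

variable {A : Type*} [CommRing A]

/-- For a decreasing sequence `V` of ideals, the polynomials all of whose monomials `c Z ^ t` have
weight `≥ m`, where `Z` has weight `1` and the elements of `V i` have weight `≥ i`. The subtraction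
`m - t` is truncated, so the condition on `c` is `c ∈ V 0` as soon as `t ≥ m`. -/
noncomputable def weightSubmodule (V : ℕ → Ideal A) (m : ℕ) : Submodule A A[X] :=
  ⨅ t, Submodule.comap (lcoeff A t) (V (m - t))

theorem mem_weightSubmodule {V : ℕ → Ideal A} {m : ℕ} {p : A[X]} :
    p ∈ weightSubmodule V m ↔ ∀ t, p.coeff t ∈ V (m - t) := by
  simp [weightSubmodule]

theorem X_pow_mul_C_mem_weightSubmodule {V : ℕ → Ideal A} {m k : ℕ} {c : A}
    (hc : c ∈ V (m - k)) : X ^ k * C c ∈ weightSubmodule V m := by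
  refine mem_weightSubmodule.2 fun t => ?_
  rw [coeff_mul_C, coeff_X_pow]
  split_ifs with ht
  · simpa [ht] using hc
  · simp

theorem X_pow_mul_mem_weightSubmodule {V : ℕ → Ideal A} (hV : V 0 = ⊤) (m : ℕ) (q : A[X]) :
    X ^ m * q ∈ weightSubmodule V m := by
  refine mem_weightSubmodule.2 fun t => ?_
  rw [coeff_X_pow_mul']
  split_ifs with ht
  · simp [Nat.sub_eq_zero_of_le ht, hV]
  · exact zero_mem _

theorem taylor_mem_weightSubmodule {I : Ideal A} (𝓕 : I.Filtration A) {g : A} (hg : g ∈ I)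
    {m : ℕ} {p : A[X]} (hp : p ∈ weightSubmodule 𝓕.N m) :
    taylor g p ∈ weightSubmodule 𝓕.N m := by
  rw [mem_weightSubmodule] at hp ⊢
  intro t
  rw [taylor_coeff, eval_eq_sum_range]
  refine sum_mem fun s _ => 𝓕.antitone (show m - t ≤ s + (m - (s + t)) by omega) ?_
  rw [hasseDeriv_coeff, mul_comm]
  exact 𝓕.pow_smul_le s _ (Submodule.smul_mem_smul (Ideal.pow_mem_pow hg s)
    (Ideal.mul_mem_left _ _ (hp (s + t))))

theorem taylor_mem_weightSubmodule_iff_of_sub_mem {I : Ideal A} (𝓕 : I.Filtration A) {g h : A}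
    (hgh : g - h ∈ I) {m : ℕ} {p : A[X]} :
    taylor g p ∈ weightSubmodule 𝓕.N m ↔ taylor h p ∈ weightSubmodule 𝓕.N m := by
  constructor <;> intro hp
  · simpa [taylor_taylor] using taylor_mem_weightSubmodule 𝓕 (I.neg_mem hgh) hp
  · simpa [taylor_taylor] using taylor_mem_weightSubmodule 𝓕 hgh hp

theorem natDegree_X_sub_C_pow_le (h : A) (k : ℕ) : ((X - C h) ^ k).natDegree ≤ k := by
  simpa using natDegree_pow_le_of_le k (natDegree_X_sub_C_le h)

theorem exists_eq_sum_taylor_add_X_sub_C_pow_mul (p : A[X]) (h : A) (m : ℕ) :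
    ∃ q : A[X], q.natDegree ≤ p.natDegree - m ∧
      p = ∑ t ∈ Finset.range m, (X - C h) ^ t * C ((taylor h p).coeff t) +
        (X - C h) ^ m * q := by
  set N := p.natDegree + 1 - m
  refine ⟨∑ t ∈ Finset.range N, (X - C h) ^ t * C ((taylor h p).coeff (m + t)),
    natDegree_sum_le_of_forall_le _ _ fun t ht => ?_, ?_⟩
  · have := natDegree_X_sub_C_pow_le h t
    have := Finset.mem_range.1 ht
    exact (natDegree_mul_C_le _ _).trans (by omega)
  · have hlt : (taylor h p).natDegree < m + N := by
      rw [natDegree_taylor]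
      omega
    conv_lhs => rw [← sum_taylor_eq p h, sum_over_range' _ (by simp) _ hlt, Finset.sum_range_add]
    simp only [Finset.mul_sum, mul_comm (C _), pow_add, mul_assoc]

/-- The polynomials of degree at most `ℓ` whose expansion in powers of `Z - h` has all its
monomials `c (Z - h) ^ t` of weight `≥ m`, in the sense of `weightSubmodule`. -/
noncomputable def interpolationSubmodule (V : ℕ → Ideal A) (h : A) (m ℓ : ℕ) : Submodule A A[X] :=
  (weightSubmodule V m).comap (taylor h) ⊓ degreeLE A ℓ

theorem mem_interpolationSubmodule {V : ℕ → Ideal A} {h : A} {m ℓ : ℕ} {p : A[X]} :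
    p ∈ interpolationSubmodule V h m ℓ ↔ taylor h p ∈ weightSubmodule V m ∧ p.degree ≤ ℓ := by
  simp [interpolationSubmodule, mem_degreeLE]

/-- The generators `(Z - h) ^ (m - i) s` and `Z ^ (ℓ' - m) (Z - h) ^ m s` of the interpolation
module, where `s` runs through a given set `S i` of generators of the ideal `V i` (through `S 0`
for the second kind). -/
def interpolationGenerators (S : ℕ → Set A) (h : A) (m ℓ : ℕ) : Set A[X] :=
  {p | ∃ i ≤ m, ∃ s ∈ S i, p = (X - C h) ^ (m - i) * C s} ∪
    {p | ∃ ℓ', m < ℓ' ∧ ℓ' ≤ ℓ ∧ ∃ s ∈ S 0, p = X ^ (ℓ' - m) * (X - C h) ^ m * C s}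

theorem interpolationGenerators_subset {V : ℕ → Ideal A} (hV : V 0 = ⊤) {S : ℕ → Set A} {m ℓ : ℕ}
    (hS : ∀ i ≤ m, S i ⊆ V i) (hmℓ : m ≤ ℓ) (h : A) :
    interpolationGenerators S h m ℓ ⊆ interpolationSubmodule V h m ℓ := by
  rintro p (⟨i, hi, s, hs, rfl⟩ | ⟨l, hml, hlℓ, s, -, rfl⟩) <;>
    refine mem_interpolationSubmodule.2 ⟨?_, degree_le_of_natDegree_le ?_⟩
  · have hs' : s ∈ V (m - (m - i)) := by
      rw [Nat.sub_sub_self hi]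
      exact hS i hi hs
    simpa using X_pow_mul_C_mem_weightSubmodule hs'
  · exact (natDegree_mul_C_le _ _).trans ((natDegree_X_sub_C_pow_le h _).trans (by omega))
  · have htaylor : taylor h (X ^ (l - m) * (X - C h) ^ m * C s) =
        X ^ m * ((X + C h) ^ (l - m) * C s) := by
      simp only [taylor_mul, taylor_pow, map_sub, taylor_X, taylor_C, add_sub_cancel_right]
      ring
    rw [htaylor]
    exact X_pow_mul_mem_weightSubmodule hV m _
  · refine (natDegree_mul_C_le _ _).trans (natDegree_mul_le.trans ?_)
    have := natDegree_X_pow_le (R := A) (l - m)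
    have := natDegree_X_sub_C_pow_le h m
    omega

variable {R : Type*} [CommSemiring R] [Algebra R A]

theorem mul_C_mem_of_mem_span {s : Set A} {N : Submodule R A[X]} {q : A[X]}
    (hN : ∀ g ∈ s, q * C g ∈ N) {c : A} (hc : c ∈ Submodule.span R s) : q * C c ∈ N :=
  (Submodule.span_le (p := N.comap (LinearMap.mulLeft R q ∘ₗ CAlgHom.toLinearMap))).2 hN hc

theorem X_sub_C_pow_mul_C_mem_span {S : ℕ → Set A} {h : A} {m ℓ i : ℕ} (hi : i ≤ m) {c : A}
    (hc : c ∈ Submodule.span R (S i)) :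
    (X - C h) ^ (m - i) * C c ∈ Submodule.span R (interpolationGenerators S h m ℓ) :=
  mul_C_mem_of_mem_span
    (fun s hs => Submodule.subset_span (Or.inl ⟨i, hi, s, hs, rfl⟩)) hc

theorem X_pow_mul_X_sub_C_pow_mul_C_mem_span {S : ℕ → Set A} {h : A} {m ℓ k : ℕ}
    (hk : m + k ≤ ℓ) {c : A} (hc : c ∈ Submodule.span R (S 0)) :
    X ^ k * (X - C h) ^ m * C c ∈ Submodule.span R (interpolationGenerators S h m ℓ) := by
  rcases k.eq_zero_or_pos with rfl | hk0
  · simpa using X_sub_C_pow_mul_C_mem_span m.zero_le hc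
  · refine mul_C_mem_of_mem_span (fun s hs => Submodule.subset_span
      (Or.inr ⟨m + k, by omega, hk, s, hs, ?_⟩)) hc
    rw [Nat.add_sub_cancel_left]

theorem span_interpolationGenerators {V : ℕ → Ideal A} (hV : V 0 = ⊤) {S : ℕ → Set A} {m ℓ : ℕ}
    (hS : ∀ i ≤ m, Submodule.span R (S i) = (V i).restrictScalars R) (hmℓ : m ≤ ℓ) (h : A) :
    Submodule.span R (interpolationGenerators S h m ℓ) =
      (interpolationSubmodule V h m ℓ).restrictScalars R := by
  have subset_ideal {i : ℕ} (hi : i ≤ m) : S i ⊆ V i :=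
    (Submodule.span_le (p := (V i).restrictScalars R)).1 (hS i hi).le
  have mem_span {i : ℕ} (hi : i ≤ m) {c : A} (hc : c ∈ V i) : c ∈ Submodule.span R (S i) :=
    (hS i hi).ge hc
  refine le_antisymm (Submodule.span_le.2 (interpolationGenerators_subset hV
    (fun _ => subset_ideal) hmℓ h)) fun p hp => ?_
  obtain ⟨hweight, hdeg⟩ := mem_interpolationSubmodule.1 hp
  obtain ⟨q, hq, hpq⟩ := exists_eq_sum_taylor_add_X_sub_C_pow_mul p h m
  have hpℓ := natDegree_le_of_degree_le hdeg
  rw [hpq]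
  refine add_mem (sum_mem fun t ht => ?_) ?_
  · have ht' := (Finset.mem_range.1 ht).le
    simpa only [Nat.sub_sub_self ht'] using X_sub_C_pow_mul_C_mem_span (m.sub_le t)
      (mem_span (m.sub_le t) (mem_weightSubmodule.1 hweight t))
  · rw [q.as_sum_range_C_mul_X_pow, Finset.mul_sum]
    refine sum_mem fun k hk => ?_
    have hk' := Finset.mem_range.1 hk
    rw [mul_comm (C _), ← mul_assoc, mul_comm (_ ^ m)]
    exact X_pow_mul_X_sub_C_pow_mul_C_mem_span (by omega)
      (mem_span m.zero_le (hV ▸ Submodule.mem_top))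

end WeightedPolynomials

theorem le_of_forall_exists_valuation_sub_lt {R F : Type*} [Ring R] [Ring F] [Module R F]
    (v : Valuation F (WithZero (Multiplicative ℤ))) {M N : Submodule R F} (hNM : N ≤ M) {B : ℤ}
    (hB : ∀ f ∈ M, f ≠ 0 → WithZero.exp B ≤ v f)
    (happrox : ∀ f ∈ M, f ≠ 0 → ∃ g ∈ N, v (f - g) < v f) : M ≤ N := by
  intro f hf
  induction hk : (WithZero.log (v f) - B).toNat using Nat.strong_induction_on generalizing f with
  | _ k ih =>
  by_cases hf0 : f = 0
  · exact hf0 ▸ zero_mem N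
  obtain ⟨g, hg, hlt⟩ := happrox f hf hf0
  suffices f - g ∈ N by simpa using add_mem this hg
  by_cases hfg : f - g = 0
  · exact hfg ▸ zero_mem N
  have hmem : f - g ∈ M := sub_mem hf (hNM hg)
  have hpos : v (f - g) ≠ 0 := (WithZero.exp_pos.trans_le (hB _ hmem hfg)).ne'
  have hge := (WithZero.le_log_iff_exp_le hpos).2 (hB _ hmem hfg)
  have hloglt := (WithZero.log_lt_log hpos hlt.ne_bot).2 hlt
  exact ih _ (by omega) hmem rfl

section Places

variable {K F : Type*} [Field K] [Field F] [Algebra K F]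

namespace Place

theorem val_eq_exp_neg_ord (P : Place K F) {f : F} (hf : f ≠ 0) :
    P.val f = WithZero.exp (-P.ord f) := by
  rw [ord, neg_neg, WithZero.exp_log ((Valuation.ne_zero_iff _).2 hf)]

theorem eq_zero_or_le_ord_iff (P : Place K F) (f : F) (k : ℤ) :
    (f = 0 ∨ k ≤ P.ord f) ↔ P.val f ≤ WithZero.exp (-k) := by
  by_cases hf : f = 0
  · simp [hf]
  · rw [P.val_eq_exp_neg_ord hf, WithZero.exp_le_exp, neg_le_neg_iff, or_iff_right hf]

theorem ord_pow (P : Place K F) (f : F) (k : ℕ) : P.ord (f ^ k) = k * P.ord f := by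
  simp [ord, WithZero.log_pow]

theorem exists_hasValue {Q : Place K F} (hQ : Q.deg = 1) {u : F} (hu : Q.val u ≤ 1) :
    ∃ c : K, Q.HasValue u c := by
  obtain ⟨c, hc⟩ := (finrank_eq_one_iff_of_nonzero' (K := K)
    (1 : IsLocalRing.ResidueField Q.ring) one_ne_zero).1 hQ
      (IsLocalRing.residue Q.ring ⟨u, hu⟩)
  have hres : IsLocalRing.residue Q.ring (⟨u, hu⟩ - algebraMap K Q.ring c) = 0 := by
    rw [map_sub, ← hc, Algebra.smul_def, mul_one, sub_eq_zero]
    rfl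
  rw [IsLocalRing.residue_eq_zero_iff] at hres
  exact ⟨c, (Valuation.mem_maximalIdeal_iff (v := Q.val)).1 hres⟩

theorem exists_val_sub_smul_lt {Q : Place K F} (hQ : Q.deg = 1) {f g : F} (hg : g ≠ 0)
    (hfg : Q.val f ≤ Q.val g) : ∃ c : K, Q.val (f - c • g) < Q.val g := by
  have hg' : 0 < Q.val g := zero_lt_iff.2 ((Valuation.ne_zero_iff _).2 hg)
  obtain ⟨c, hc⟩ := exists_hasValue hQ (u := f / g) (by
    rw [map_div₀]
    exact div_le_one_of_le₀ hfg zero_le)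
  refine ⟨c, ?_⟩
  have hfactor : f - c • g = (f / g - algebraMap K F c) * g := by
    rw [Algebra.smul_def]
    field_simp
  rw [hfactor, map_mul]
  exact mul_lt_of_lt_one_left hg' hc

end Place

theorem HasPoleDivisor.ord_eq_neg {Q : Place K F} {f : F} {a : ℕ}
    (hf : HasPoleDivisor f (a • Q.toDivisor)) (ha : 0 < a) : Q.ord f = -a := by
  have := hf.2 Q
  simp only [Place.toDivisor, Finsupp.smul_apply, Finsupp.single_eq_same, nsmul_eq_mul,
    mul_one] at this
  omega

theorem mem_spaceInfty_iff {A : FFDivisor K F} {Q : Place K F} {f : F} :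
    f ∈ spaceInfty A Q ↔ ∀ P ≠ Q, P.val f ≤ WithZero.exp (A P) := by
  have val_le_iff (P : Place K F) :
      P.val f ≤ WithZero.exp (A P) ↔ f = 0 ∨ 0 ≤ P.ord f + A P := by
    rw [← neg_neg (A P), ← P.eq_zero_or_le_ord_iff, neg_neg, neg_le_iff_add_nonneg]
  simp only [spaceInfty, riemannRochSpace, Set.mem_iUnion, Set.mem_Ici, Set.mem_ofPred_eq,
    val_le_iff, Finsupp.add_apply, Finsupp.smul_apply, Place.toDivisor, nsmul_eq_mul]
  constructor
  · rintro ⟨i, -, hi⟩ P hPQ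
    refine hi.imp_right fun hi => ?_
    simpa [Finsupp.single_eq_of_ne hPQ] using hi P
  · intro hf
    refine ⟨(-(Q.ord f + A Q)).toNat + 1, by omega, or_iff_not_imp_left.2 fun hf0 P => ?_⟩
    by_cases hPQ : P = Q
    · subst hPQ
      rw [Finsupp.single_eq_same]
      push_cast
      omega
    · simpa [Finsupp.single_eq_of_ne hPQ] using (hf P hPQ).resolve_left hf0

theorem val_le_one_of_mem_ringInfty {P Q : Place K F} (hPQ : P ≠ Q) (f : ringInfty Q) :
    P.val (f : F) ≤ 1 := by
  simpa using mem_spaceInfty_iff.1 f.2 P hPQ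

/-- `L(A + ∞Q)` as a module over the ring `L(∞Q)`. -/
def submoduleInfty (A : FFDivisor K F) (Q : Place K F) : Submodule (ringInfty Q) F where
  carrier := spaceInfty A Q
  zero_mem' := mem_spaceInfty_iff.2 fun P _ => by simp
  add_mem' hf hg := mem_spaceInfty_iff.2 fun P hPQ =>
    P.val.map_add_le (mem_spaceInfty_iff.1 hf P hPQ) (mem_spaceInfty_iff.1 hg P hPQ)
  smul_mem' c f hf := mem_spaceInfty_iff.2 fun P hPQ => by
    rw [Algebra.smul_def, map_mul]
    exact (mul_le_of_le_one_left' (val_le_one_of_mem_ringInfty hPQ c)).trans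
      (mem_spaceInfty_iff.1 hf P hPQ)

theorem IsMinimalPoleOrder.exists_ord_le {A : FFDivisor K F} {Q : Place K F} {a : ℕ} (ha : 0 < a)
    {η : ℕ → F} (hη : ∀ j < a, IsMinimalPoleOrder A Q a j (η j)) :
    ∃ B : ℤ, ∀ f ∈ spaceInfty A Q, f ≠ 0 → Q.ord f ≤ B := by
  obtain ⟨B, hB⟩ := ((Finset.range a).image fun j => Q.ord (η j)).exists_le
  refine ⟨B, fun f hf hf0 => ?_⟩
  obtain ⟨j, hj, hmod⟩ := Int.existsUnique_equiv_nat (-Q.ord f) (Int.natCast_pos.2 ha)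
  have hja : j < a := by exact_mod_cast hj
  have hmin := (hη j hja).2 f hf hf0 hmod.symm
  have := hB _ (Finset.mem_image_of_mem _ (Finset.mem_range.2 hja))
  omega

theorem IsMinimalPoleOrder.exists_val_pow_mul_eq {A : FFDivisor K F} {Q : Place K F} {a j : ℕ}
    {x η f : F} (ha : 0 < a) (hx : Q.ord x = -a) (hη : IsMinimalPoleOrder A Q a j η)
    (hf : f ∈ spaceInfty A Q) (hf0 : f ≠ 0) (hmod : -Q.ord f ≡ j [ZMOD a]) :
    ∃ d : ℕ, Q.val (x ^ d * η) = Q.val f := by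
  obtain ⟨⟨-, hη0, hηmod⟩, hmin⟩ := hη
  have hx0 : x ≠ 0 := by
    rintro rfl
    simp only [Place.ord, map_zero, WithZero.log_zero] at hx
    omega
  obtain ⟨d, hd⟩ := (hηmod.trans hmod.symm).dvd
  have hd0 : 0 ≤ d := nonneg_of_mul_nonneg_right
    (hd ▸ sub_nonneg.2 (hmin f hf hf0 hmod)) (Int.natCast_pos.2 ha)
  lift d to ℕ using hd0
  refine ⟨d, ?_⟩
  rw [Q.val_eq_exp_neg_ord hf0, Q.val_eq_exp_neg_ord (mul_ne_zero (pow_ne_zero d hx0) hη0),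
    Q.ord_mul (pow_ne_zero d hx0) hη0, Q.ord_pow, hx]
  congr 1
  linarith

theorem span_eq_submoduleInfty {A : FFDivisor K F} {Q : Place K F} (hQ : Q.deg = 1) {a : ℕ}
    (ha : 0 < a) {x : ringInfty Q} (hx : Q.ord (x : F) = -a) {η : ℕ → F}
    (hη : ∀ j < a, IsMinimalPoleOrder A Q a j (η j)) :
    Submodule.span (Algebra.adjoin K {x}) (η '' Set.Iio a) =
      (submoduleInfty A Q).restrictScalars (Algebra.adjoin K {x}) := by
  have hle : Submodule.span (Algebra.adjoin K {x}) (η '' Set.Iio a) ≤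
      (submoduleInfty A Q).restrictScalars (Algebra.adjoin K {x}) :=
    Submodule.span_le.2 (Set.image_subset_iff.2 fun j hj => (hη j hj).1.1)
  obtain ⟨B, hB⟩ := IsMinimalPoleOrder.exists_ord_le ha hη
  refine le_antisymm hle (le_of_forall_exists_valuation_sub_lt Q.val hle (B := -B)
    (fun f hf hf0 => ?_) fun f hf hf0 => ?_)
  · rw [Q.val_eq_exp_neg_ord hf0, WithZero.exp_le_exp]
    exact neg_le_neg (hB f hf hf0)
  · obtain ⟨j, hj, hmod⟩ := Int.existsUnique_equiv_nat (-Q.ord f) (Int.natCast_pos.2 ha)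
    have hja : j < a := by exact_mod_cast hj
    obtain ⟨d, hd⟩ := (hη j hja).exists_val_pow_mul_eq ha hx hf hf0 hmod.symm
    have hne : (x : F) ^ d * η j ≠ 0 := by
      rwa [← Valuation.ne_zero_iff Q.val, hd, Valuation.ne_zero_iff]
    obtain ⟨c, hc⟩ := Place.exists_val_sub_smul_lt hQ hne hd.ge
    let y : Algebra.adjoin K {x} := ⟨x, Algebra.self_mem_adjoin_singleton K x⟩
    have hmem : η j ∈ Submodule.span (Algebra.adjoin K {x}) (η '' Set.Iio a) :=
      Submodule.subset_span ⟨j, hja, rfl⟩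
    exact ⟨c • (y ^ d • η j), Submodule.smul_of_tower_mem _ c (Submodule.smul_mem _ _ hmem),
      hd ▸ hc⟩

/-- The ideal of `L(∞Q)` formed by its elements that lie in `L(A + ∞Q)`. -/
def idealInfty (A : FFDivisor K F) (Q : Place K F) : Ideal (ringInfty Q) :=
  (submoduleInfty A Q).comap (Algebra.linearMap (ringInfty Q) F)

theorem mem_idealInfty {A : FFDivisor K F} {Q : Place K F} {f : ringInfty Q} :
    f ∈ idealInfty A Q ↔ ∀ P ≠ Q, P.val (f : F) ≤ WithZero.exp (A P) :=
  mem_spaceInfty_iff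

theorem span_eq_idealInfty {A : FFDivisor K F} {Q : Place K F} (hQ : Q.deg = 1) {a : ℕ}
    (ha : 0 < a) {x : ringInfty Q} (hx : Q.ord (x : F) = -a) {η : ℕ → ringInfty Q}
    (hη : ∀ j < a, IsMinimalPoleOrder A Q a j (η j : F)) :
    Submodule.span (Algebra.adjoin K {x}) (η '' Set.Iio a) =
      (idealInfty A Q).restrictScalars (Algebra.adjoin K {x}) := by
  let ι : ringInfty Q →ₗ[Algebra.adjoin K {x}] F :=
    (Algebra.linearMap (ringInfty Q) F).restrictScalars _
  have hι : Function.Injective ι := Subtype.val_injective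
  rw [← Submodule.comap_map_eq_of_injective hι (Submodule.span _ _), Submodule.map_span,
    Set.image_image]
  exact congrArg (Submodule.comap ι) (span_eq_submoduleInfty hQ ha hx hη)

theorem idealInfty_zero (Q : Place K F) : idealInfty 0 Q = ⊤ :=
  eq_top_iff.2 fun f _ => f.2

theorem idealInfty_mono {A B : FFDivisor K F} (hAB : A ≤ B) (Q : Place K F) :
    idealInfty A Q ≤ idealInfty B Q := fun _ hf => mem_idealInfty.2 fun P hPQ =>
  (mem_idealInfty.1 hf P hPQ).trans (WithZero.exp_le_exp.2 (hAB P))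

theorem idealInfty_mul_le (A B : FFDivisor K F) (Q : Place K F) :
    idealInfty A Q * idealInfty B Q ≤ idealInfty (A + B) Q :=
  Ideal.mul_le.2 fun f hf g hg => mem_idealInfty.2 fun P hPQ => by
    rw [MulMemClass.coe_mul, map_mul, Finsupp.add_apply, WithZero.exp_add]
    exact mul_le_mul' (mem_idealInfty.1 hf P hPQ) (mem_idealInfty.1 hg P hPQ)

/-- The filtration of `L(∞Q)` by the order of vanishing along an effective divisor `D`. -/
noncomputable def vanishingFiltration (Q : Place K F) {D : FFDivisor K F} (hD : 0 ≤ D) :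
    (idealInfty (-D) Q).Filtration (ringInfty Q) where
  N i := idealInfty (-(i • D)) Q
  mono i := idealInfty_mono (neg_le_neg (nsmul_le_nsmul_left hD i.le_succ)) Q
  smul_le i := (idealInfty_mul_le _ _ Q).trans_eq (by rw [succ_nsmul', neg_add])

theorem mem_idealInfty_neg_nsmul_sum_iff {ι : Type*} [Fintype ι] {P : ι → Place K F}
    (hP : Function.Injective P) {Q : Place K F} (hPQ : ∀ k, P k ≠ Q) {i : ℕ} {f : ringInfty Q} :
    f ∈ idealInfty (-(i • ∑ k, (P k).toDivisor)) Q ↔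
      ∀ k, (P k).val (f : F) ≤ WithZero.exp (-(i : ℤ)) := by
  classical
  have hmem (k : ι) : (i • ∑ k, (P k).toDivisor) (P k) = i := by
    simp [Place.toDivisor, Finsupp.single_apply, hP.eq_iff]
  simp only [mem_idealInfty, Finsupp.neg_apply]
  refine ⟨fun hf k => hmem k ▸ hf (P k) (hPQ k), fun hf R hRQ => ?_⟩
  by_cases hR : ∃ k, P k = R
  · obtain ⟨k, rfl⟩ := hR
    exact (hmem k).symm ▸ hf k
  · have hR0 : (i • ∑ k, (P k).toDivisor) R = 0 := by
      simp [Place.toDivisor, not_exists.1 hR]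
    rw [hR0, neg_zero, WithZero.exp_zero]
    exact val_le_one_of_mem_ringInfty hRQ f

theorem mem_idealInfty_neg_nsmul_iff {P Q : Place K F} (hPQ : P ≠ Q) {i : ℕ} {f : ringInfty Q} :
    f ∈ idealInfty (-(i • P.toDivisor)) Q ↔ P.val (f : F) ≤ WithZero.exp (-(i : ℤ)) := by
  simpa using mem_idealInfty_neg_nsmul_sum_iff (P := fun _ : Unit => P)
    (Function.injective_of_subsingleton _) (fun _ => hPQ) (i := i) (f := f)

theorem idealInfty_neg_nsmul_sum {ι : Type*} [Fintype ι] {P : ι → Place K F}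
    (hP : Function.Injective P) {Q : Place K F} (hPQ : ∀ k, P k ≠ Q) (i : ℕ) :
    idealInfty (-(i • ∑ k, (P k).toDivisor)) Q = ⨅ k, idealInfty (-(i • (P k).toDivisor)) Q := by
  ext f
  simp only [Submodule.mem_iInf, mem_idealInfty_neg_nsmul_sum_iff hP hPQ,
    mem_idealInfty_neg_nsmul_iff (hPQ _)]

theorem hasMultiplicity_iff_taylor_algebraMap_mem {P Q : Place K F} (hPQ : P ≠ Q)
    {p : (ringInfty Q)[X]} {r : K} {m : ℕ} :
    HasMultiplicity p P r m ↔ taylor (algebraMap K (ringInfty Q) r) p ∈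
      weightSubmodule (fun i => idealInfty (-(i • P.toDivisor)) Q) m := by
  rw [mem_weightSubmodule, taylor_apply]
  refine forall_congr' fun t => ?_
  simp only [mem_idealInfty_neg_nsmul_iff hPQ, ← sub_le_iff_le_add, P.eq_zero_or_le_ord_iff]
  rcases le_total t m with ht | ht
  · rw [Nat.cast_sub ht]
  · have hle := val_le_one_of_mem_ringInfty hPQ
      ((p.comp (X + C (algebraMap K (ringInfty Q) r))).coeff t)
    refine iff_of_true (hle.trans ?_) (hle.trans ?_) <;>
      rw [← WithZero.exp_zero, WithZero.exp_le_exp] <;> omega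

theorem hasMultiplicity_iff_taylor_mem {P Q : Place K F} (hPQ : P ≠ Q) {r : K}
    {h : ringInfty Q} (hh : P.HasValue (h : F) r) {p : (ringInfty Q)[X]} {m : ℕ} :
    HasMultiplicity p P r m ↔ taylor h p ∈
      weightSubmodule (fun i => idealInfty (-(i • P.toDivisor)) Q) m := by
  have hsub : h - algebraMap K (ringInfty Q) r ∈ idealInfty (-P.toDivisor) Q := by
    rw [← one_nsmul P.toDivisor, mem_idealInfty_neg_nsmul_iff hPQ,
      ← WithZero.lt_mul_exp_iff_le WithZero.exp_ne_zero, ← WithZero.exp_add]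
    simpa [Place.HasValue] using hh
  rw [hasMultiplicity_iff_taylor_algebraMap_mem hPQ]
  exact (taylor_mem_weightSubmodule_iff_of_sub_mem
    (vanishingFiltration Q (toDivisor_nonneg · P)) hsub).symm

theorem interpolationModule_eq {Q : Place K F} {n : ℕ} {P : Fin n → Place K F}
    (hP : Function.Injective P) (hPQ : ∀ k, P k ≠ Q) {r : Fin n → K} {h : ringInfty Q}
    (hh : ∀ k, (P k).HasValue (h : F) (r k)) (m ℓ : ℕ) :
    interpolationModule Q P r m ℓ = interpolationSubmodule
      (fun i => idealInfty (-(i • ∑ k, (P k).toDivisor)) Q) h m ℓ := by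
  ext p
  simp only [interpolationModule, Set.mem_ofPred_eq, SetLike.mem_coe, mem_interpolationSubmodule,
    hasMultiplicity_iff_taylor_mem (hPQ _) (hh _), mem_weightSubmodule,
    idealInfty_neg_nsmul_sum hP hPQ, Submodule.mem_iInf]
  rw [forall_comm]

end Places

theorem mainTheorem4_general {K F : Type*} [Field K] [Field F] [Algebra K F]
    (Q : Place K F) (hQ : Q.deg = 1) (n : ℕ) (P : Fin n → Place K F)
    (hPinj : Function.Injective P) (hPQ : ∀ i, P i ≠ Q)
    (a₁ : ℕ) (ha₁ : 0 < a₁) (x₁ : ringInfty Q)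
    (hx₁ : HasPoleDivisor (x₁ : F) (a₁ • Q.toDivisor))
    (r : Fin n → K) (h : ringInfty Q) (hh : ∀ i, (P i).HasValue (h : F) (r i))
    (m ℓ : ℕ) (hmℓ : m ≤ ℓ)
    (η : ℕ → ℕ → ringInfty Q)
    (hη : ∀ i ≤ m, ∀ j < a₁,
      IsMinimalPoleOrder (-(i • ∑ k, (P k).toDivisor)) Q a₁ j (η i j : F)) :
    (Submodule.span (Algebra.adjoin K {x₁})
      ({p : (ringInfty Q)[X] | ∃ i ≤ m, ∃ j < a₁, p = (X - C h) ^ (m - i) * C (η i j)} ∪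
       {p : (ringInfty Q)[X] | ∃ ℓ', m < ℓ' ∧ ℓ' ≤ ℓ ∧ ∃ j < a₁,
          p = X ^ (ℓ' - m) * (X - C h) ^ m * C (η 0 j)}) : Set (ringInfty Q)[X]) =
      interpolationModule Q P r m ℓ := by
  have hspan (i : ℕ) (hi : i ≤ m) :
      Submodule.span (Algebra.adjoin K {x₁}) (η i '' Set.Iio a₁) =
        (idealInfty (-(i • ∑ k, (P k).toDivisor)) Q).restrictScalars _ :=
    span_eq_idealInfty hQ ha₁ (hx₁.ord_eq_neg ha₁) (hη i hi)
  have hgen := span_interpolationGenerators (by simp [idealInfty_zero]) hspan hmℓ h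
  simp only [interpolationGenerators, Set.exists_mem_image, Set.mem_Iio] at hgen
  rw [hgen, interpolationModule_eq hPinj hPQ hh, Submodule.coe_restrictScalars]

theorem mainTheorem4 {K F : Type*} [Field K] [Finite K] [Field F] [Algebra K F]
    (hF : IsAlgebraicFunctionField K F)
    (Q : Place K F) (hQ : Q.deg = 1)
    (n : ℕ) (P : Fin n → Place K F) (hP : ∀ i, (P i).deg = 1)
    (hPinj : Function.Injective P) (hPQ : ∀ i, P i ≠ Q)
    (a₁ : ℕ) (ha₁ : 0 < a₁) (x₁ : ringInfty Q)
    (hx₁ : HasPoleDivisor (x₁ : F) (a₁ • Q.toDivisor))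
    (r : Fin n → K) (h : ringInfty Q) (hh : ∀ i, (P i).HasValue (h : F) (r i))
    (m ℓ : ℕ) (hmℓ : m ≤ ℓ)
    (η : ℕ → ℕ → ringInfty Q)
    (hη : ∀ i ≤ m, ∀ j < a₁,
      IsMinimalPoleOrder (-(i • ∑ k, (P k).toDivisor)) Q a₁ j (η i j : F)) :
    (Submodule.span (Algebra.adjoin K {x₁})
      ({p : (ringInfty Q)[X] | ∃ i ≤ m, ∃ j < a₁, p = (X - C h) ^ (m - i) * C (η i j)} ∪
       {p : (ringInfty Q)[X] | ∃ ℓ', m < ℓ' ∧ ℓ' ≤ ℓ ∧ ∃ j < a₁,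
          p = X ^ (ℓ' - m) * (X - C h) ^ m * C (η 0 j)}) : Set (ringInfty Q)[X]) =
      interpolationModule Q P r m ℓ :=
  mainTheorem4_general Q hQ n P hPinj hPQ a₁ ha₁ x₁ hx₁ r h hh m ℓ hmℓ η hη
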